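/- Let $X$ be a random variable taking values in a set $\mathcal{X}$. Let $d_1 \ge d_2 \ge 1$ be integers, let $\beta \ge 1$, and for each $x \in \mathcal{X}$ let $A_x \in \mathbb{C}^{d_1 \times d_2}$ satisfy $\|A_x\|_1 \le 1$ and $\|A_x\|_\infty \le \beta/d_2$, where $\|\cdot\|_1$ is the trace norm (the sum of the singular values) and $\|\cdot\|_\infty$ is the operator norm (the largest singular value). Let $A = \mathbb{E}[A_X]$. Let $X[1], \dots, X[M]$ ($M \ge 1$) be independent random variables, each distributed as $X$, and let $\tilde{A} = \frac{1}{M} \sum_{m=1}^{M} A_{X[m]}$. Then, for every $0 < \varepsilon < 1$, $$\Pr\left\{ \|\tilde{A} - A\|_1 \ge \varepsilon \right\} \le 25\, d_1 \exp\left( -10^{-11}\, \varepsilon^3\, \frac{M}{\beta} \right).$$ -/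

import Mathlib

open MeasureTheory ProbabilityTheory

/-- The trace norm (Schatten 1-norm) of a complex `m × n` matrix: the sum of its singular values,
that is, of the square roots of the `n` eigenvalues of `Aᴴ * A`, counted with multiplicity. -/
noncomputable def traceNorm {m n : ℕ} (A : Matrix (Fin m) (Fin n) ℂ) : ℝ :=
  ∑ i : Fin n, (Matrix.toEuclideanLin A).singularValues (i : ℕ)

/-- The operator norm (Schatten infinity-norm) of a complex `m × n` matrix, as a linear map between
the Euclidean spaces `ℂⁿ` and `ℂᵐ`. -/
noncomputable def operatorNorm {m n : ℕ} (A : Matrix (Fin m) (Fin n) ℂ) : ℝ :=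
  ‖LinearMap.toContinuousLinearMap (Matrix.toEuclideanLin A)‖

/-- The entrywise expectation `𝔼[A_X]` of a random matrix. -/
noncomputable def matrixExpectation {Ω 𝒳 : Type*} [MeasurableSpace Ω] {m n : ℕ}
    (P : Measure Ω) (X : Ω → 𝒳) (A : 𝒳 → Matrix (Fin m) (Fin n) ℂ) :
    Matrix (Fin m) (Fin n) ℂ :=
  Matrix.of fun i j => ∫ ω, A (X ω) i j ∂P

/-- The sample average `(1 / M) ∑ₖ A_{x k}` over a sample `x` of size `M`. -/
noncomputable def sampleAverage {𝒳 : Type*} {m n M : ℕ}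
    (A : 𝒳 → Matrix (Fin m) (Fin n) ℂ) (x : Fin M → 𝒳) : Matrix (Fin m) (Fin n) ℂ :=
  ((M : ℂ)⁻¹) • ∑ k : Fin M, A (x k)

/-! Passing to the Frobenius norm makes the problem Hilbertian. The bounds on the trace and operator
norms give `‖A_x‖₂² ≤ ‖A_x‖₁ ‖A_x‖_∞ ≤ β/d₂`, and Cauchy–Schwarz on the singular values gives `‖B‖₁
≤ √d₂ ‖B‖₂`. The two factors of `d₂` cancel in the dimension-free inequality
`measureReal_le_norm_sum_le`, leaving `2 exp(-Mε²/(8β))`, which is stronger than the claim. That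
inequality is a Chernoff bound with `cosh ‖·‖` as exponential moment: each independent centred
summand of norm at most `b` multiplies its mean by at most `cosh b`. -/

/-- The chord bound for the convex function `s ↦ cosh √s` on `[(a - b)², (a + b)²]`. -/
theorem Real.cosh_le_chord {a b t r : ℝ} (ha : 0 < a) (hb : 0 < b) (ht : |t| ≤ a * b)
    (hr : r ^ 2 ≤ a ^ 2 + b ^ 2 + 2 * t) :
    Real.cosh r ≤ Real.cosh a * Real.cosh b + t * (Real.sinh a * Real.sinh b / (a * b)) := by
  obtain ⟨u, hu⟩ : ∃ u, u = t / (a * b) := ⟨_, rfl⟩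
  have hab : 0 < a * b := mul_pos ha hb
  have htu : t = u * (a * b) := by rw [hu]; field_simp
  have hu1 : |u| ≤ 1 := by
    rw [hu, abs_div, abs_of_pos hab]
    exact (div_le_one hab).2 ht
  obtain ⟨hu1, hu2⟩ := abs_le.1 hu1
  -- With `u = t/(ab)`, `r²` is at most a convex combination of `(a ± b)²`; convexity of `s ↦ sⁿ`
  -- compares the power series of `cosh` term by term.
  have key : Real.cosh r ≤
      (1 + u) / 2 * Real.cosh (a + b) + (1 - u) / 2 * Real.cosh (a - b) := by
    refine hasSum_le (fun n => ?_) (Real.hasSum_cosh r)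
      (((Real.hasSum_cosh (a + b)).mul_left ((1 + u) / 2)).add
        ((Real.hasSum_cosh (a - b)).mul_left ((1 - u) / 2)))
    have h := (convexOn_pow (𝕜 := ℝ) n).2 (Set.mem_Ici.2 (sq_nonneg (a + b)))
      (Set.mem_Ici.2 (sq_nonneg (a - b))) (show 0 ≤ (1 + u) / 2 by linarith)
      (show 0 ≤ (1 - u) / 2 by linarith) (by ring)
    simp only [smul_eq_mul] at h
    have h2 : (r ^ 2) ^ n ≤ ((1 + u) / 2 * (a + b) ^ 2 + (1 - u) / 2 * (a - b) ^ 2) ^ n := by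
      gcongr
      rw [htu] at hr
      linarith
    rw [pow_mul, pow_mul, pow_mul, ← mul_div_assoc, ← mul_div_assoc, ← add_div]
    gcongr
    exact h2.trans h
  refine key.trans_eq ?_
  rw [Real.cosh_add, Real.cosh_sub, htu]
  field_simp
  ring

theorem integrable_of_measurable_of_norm_le {Ω F : Type*} [MeasurableSpace Ω] {P : Measure Ω}
    [IsProbabilityMeasure P] [NormedAddCommGroup F] [SecondCountableTopology F]
    [MeasurableSpace F] [BorelSpace F] {f : Ω → F}
    (hf : Measurable f) {C : ℝ} (hC : ∀ ω, ‖f ω‖ ≤ C) : Integrable f P :=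
  Integrable.of_bound hf.aestronglyMeasurable C (Filter.Eventually.of_forall hC)

theorem integrable_cosh_norm {Ω F : Type*} [MeasurableSpace Ω] {P : Measure Ω}
    [IsProbabilityMeasure P] [NormedAddCommGroup F] [MeasurableSpace F] [BorelSpace F]
    {S : Ω → F} (hS : Measurable S) {R : ℝ} (hSR : ∀ ω, ‖S ω‖ ≤ R) :
    Integrable (fun ω => Real.cosh ‖S ω‖) P := by
  refine integrable_of_measurable_of_norm_le (Real.measurable_cosh.comp hS.norm)
    (C := Real.cosh R) fun ω => ?_
  rw [Real.norm_eq_abs, abs_of_pos (Real.cosh_pos _)]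
  exact Real.cosh_le_cosh.2 (by simpa using (hSR ω).trans (le_abs_self R))

/-! ### Hoeffding's inequality in Hilbert space -/

section VectorHoeffding

variable {E : Type*} [NormedAddCommGroup E] [InnerProductSpace ℝ E]

/-- The chord bound with `t = ⟪s, y⟫`. The correction is linear in `y`, so it averages to zero when
`y` is centred and independent of `s`. If `s = 0` or `b = 0`, it vanishes. -/
theorem cosh_norm_add_le {b : ℝ} (s y : E) (hy : ‖y‖ ≤ b) :
    Real.cosh ‖s + y‖ ≤ Real.cosh ‖s‖ * Real.cosh b +
      inner ℝ ((Real.sinh ‖s‖ * Real.sinh b / (‖s‖ * b)) • s) y := by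
  rcases (norm_nonneg s).eq_or_lt with hs | hs
  · have : s = 0 := norm_eq_zero.1 hs.symm
    subst this
    have h : Real.cosh ‖y‖ ≤ Real.cosh b :=
      Real.cosh_le_cosh.2 (by simpa using hy.trans (le_abs_self b))
    simpa using h
  rcases ((norm_nonneg y).trans hy).eq_or_lt with hb | hb
  · have : y = 0 := norm_eq_zero.1 (le_antisymm (hb ▸ hy) (norm_nonneg y))
    subst this
    simp [← hb]
  rw [inner_smul_left, mul_comm (starRingEnd ℝ _)]
  refine Real.cosh_le_chord hs hb ((abs_real_inner_le_norm s y).trans (by gcongr)) ?_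
  rw [norm_add_sq_real]
  have : ‖y‖ ^ 2 ≤ b ^ 2 := by gcongr
  linarith

variable [CompleteSpace E] [SecondCountableTopology E] [MeasurableSpace E] [BorelSpace E]
  {Ω : Type*} [MeasurableSpace Ω] {P : Measure Ω} [IsProbabilityMeasure P]

theorem integral_cosh_norm_add_le {S Y : Ω → E} (hS : Measurable S) (hY : Measurable Y)
    {R b : ℝ} (hSR : ∀ ω, ‖S ω‖ ≤ R) (hYb : ∀ ω, ‖Y ω‖ ≤ b) (hSY : IndepFun S Y P)
    (hY0 : ∫ ω, Y ω ∂P = 0) :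
    ∫ ω, Real.cosh ‖S ω + Y ω‖ ∂P ≤ (∫ ω, Real.cosh ‖S ω‖ ∂P) * Real.cosh b := by
  let G : E → E := fun s => (Real.sinh ‖s‖ * Real.sinh b / (‖s‖ * b)) • s
  have hG : Measurable G := by
    refine Measurable.smul (Measurable.div ?_ ?_) measurable_id
    · exact (Real.measurable_sinh.comp measurable_norm).mul_const _
    · exact measurable_norm.mul_const _
  have hGi : Integrable (G ∘ S) P := by
    refine integrable_of_measurable_of_norm_le (hG.comp hS)
      (C := Real.sinh R * |Real.sinh b / b|) fun ω => ?_
    have h1 : ‖G (S ω)‖ ≤ Real.sinh ‖S ω‖ * |Real.sinh b / b| := by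
      simp only [G, norm_smul, Real.norm_eq_abs]
      rcases eq_or_ne ‖S ω‖ 0 with h | h
      · simp [h]
      · rw [mul_div_mul_comm, abs_mul, abs_div, abs_norm,
          abs_of_nonneg (Real.sinh_nonneg_iff.2 (norm_nonneg _))]
        exact le_of_eq (by field_simp)
    refine h1.trans ?_
    gcongr
    exact Real.sinh_le_sinh.2 (hSR ω)
  have hYi : Integrable Y P := integrable_of_measurable_of_norm_le hY hYb
  have hind : IndepFun (G ∘ S) Y P := hSY.comp hG measurable_id
  have h0 : ∫ ω, inner ℝ (G (S ω)) (Y ω) ∂P = 0 := by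
    have := hind.integral_bilin hGi hYi (innerSL ℝ)
    rw [hY0, map_zero] at this
    exact this
  have hint : Integrable (fun ω => inner ℝ (G (S ω)) (Y ω)) P :=
    hind.integrable_bilin hGi hYi (innerSL ℝ)
  have hSi := integrable_cosh_norm (P := P) hS hSR
  calc ∫ ω, Real.cosh ‖S ω + Y ω‖ ∂P
      ≤ ∫ ω, (Real.cosh ‖S ω‖ * Real.cosh b + inner ℝ (G (S ω)) (Y ω)) ∂P := by
        refine integral_mono (integrable_cosh_norm (hS.add hY) (R := R + b) fun ω => ?_)
          ((hSi.mul_const _).add hint) fun ω => cosh_norm_add_le _ _ (hYb ω)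
        exact (norm_add_le _ _).trans (add_le_add (hSR ω) (hYb ω))
    _ = _ := by
        rw [integral_add (hSi.mul_const _) hint, h0, integral_mul_const, add_zero]

theorem integral_cosh_norm_sum_le {ι : Type*} {Y : ι → Ω → E} (hY : ∀ i, Measurable (Y i))
    {b : ℝ} (hYb : ∀ i ω, ‖Y i ω‖ ≤ b) (hind : iIndepFun Y P) (hY0 : ∀ i, ∫ ω, Y i ω ∂P = 0)
    (s : Finset ι) :
    ∫ ω, Real.cosh ‖∑ i ∈ s, Y i ω‖ ∂P ≤ Real.cosh b ^ s.card := by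
  classical
  induction s using Finset.induction_on with
  | empty => simp
  | insert i s hi ih =>
    have h := integral_cosh_norm_add_le (P := P) (S := ∑ j ∈ s, Y j) (R := ∑ _j ∈ s, b)
      (by simpa [Finset.sum_fn] using Finset.measurable_sum s fun j _ => hY j) (hY i)
      (fun ω => by
        rw [Finset.sum_apply]
        exact norm_sum_le_of_le s fun j _ => hYb j ω)
      (hYb i) (hind.indepFun_finsetSum_of_notMem hY hi) (hY0 i)
    simp only [Finset.sum_apply] at h
    simp only [Finset.sum_insert hi, Finset.card_insert_of_notMem hi, pow_succ]
    simp only [add_comm (Y i _)]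
    refine h.trans ?_
    gcongr

/-- **Pinelis' inequality**: a dimension-free Hoeffding bound for sums of independent bounded
centred random vectors in a Hilbert space. -/
theorem measureReal_le_norm_sum_le {ι : Type*} [Fintype ι] {Y : ι → Ω → E}
    (hY : ∀ i, Measurable (Y i)) {b r : ℝ} (hb : 0 < b) (hr : 0 ≤ r) (hι : 0 < Fintype.card ι)
    (hYb : ∀ i ω, ‖Y i ω‖ ≤ b) (hind : iIndepFun Y P) (hY0 : ∀ i, ∫ ω, Y i ω ∂P = 0) :
    P.real {ω | r ≤ ‖∑ i, Y i ω‖} ≤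
      2 * Real.exp (-(r ^ 2 / (2 * Fintype.card ι * b ^ 2))) := by
  set n : ℝ := (Fintype.card ι : ℝ) with hn
  have hn0 : 0 < n := Nat.cast_pos.2 hι
  -- The minimiser of the Chernoff exponent `n(lb)²/2 - lr`.
  obtain ⟨l, hl⟩ : ∃ l, l = r / (n * b ^ 2) := ⟨_, rfl⟩
  have hl0 : 0 ≤ l := by rw [hl]; positivity
  have hnorm : ∀ i ω, ‖l • Y i ω‖ ≤ l * b := fun i ω => by
    rw [norm_smul, Real.norm_of_nonneg hl0]
    gcongr
    exact hYb i ω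
  have hmeas : ∀ i, Measurable fun ω => l • Y i ω := fun i => (hY i).const_smul l
  have hexp := integral_cosh_norm_sum_le (P := P) hmeas hnorm
    (hind.comp (fun _ y => l • y) fun _ => measurable_id.const_smul l)
    (fun i => by rw [integral_smul, hY0, smul_zero]) Finset.univ
  have hsum : ∀ ω, ‖∑ i, l • Y i ω‖ = l * ‖∑ i, Y i ω‖ := fun ω => by
    rw [← Finset.smul_sum, norm_smul, Real.norm_of_nonneg hl0]
  have hint : Integrable (fun ω => Real.cosh ‖∑ i, l • Y i ω‖) P :=
    integrable_cosh_norm (R := ∑ _i : ι, l * b)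
      (Finset.measurable_sum _ fun i _ => hmeas i)
      fun ω => norm_sum_le_of_le _ fun i _ => hnorm i ω
  have hmarkov := mul_meas_ge_le_integral_of_nonneg
    (Filter.Eventually.of_forall fun ω => (Real.cosh_pos ‖∑ i, l • Y i ω‖).le) hint
    (Real.cosh (l * r))
  have hsub : P.real {ω | r ≤ ‖∑ i, Y i ω‖} ≤
      P.real {ω | Real.cosh (l * r) ≤ Real.cosh ‖∑ i, l • Y i ω‖} := by
    refine measureReal_mono fun ω hω => Real.cosh_le_cosh.2 ?_
    rw [abs_norm, hsum, abs_of_nonneg (by positivity)]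
    exact mul_le_mul_of_nonneg_left hω hl0
  have hcosh : Real.exp (l * r) / 2 ≤ Real.cosh (l * r) := by
    rw [Real.cosh_eq]
    have := Real.exp_pos (-(l * r))
    linarith
  have hup : Real.cosh (l * b) ^ (Finset.univ : Finset ι).card ≤
      Real.exp (n * ((l * b) ^ 2 / 2)) := by
    rw [hn, Real.exp_nat_mul, Finset.card_univ]
    exact pow_le_pow_left₀ (Real.cosh_pos _).le (Real.cosh_le_exp_half_sq _) _
  have hmain : Real.exp (l * r) / 2 * P.real {ω | r ≤ ‖∑ i, Y i ω‖} ≤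
      Real.exp (n * ((l * b) ^ 2 / 2)) :=
    (mul_le_mul hcosh hsub measureReal_nonneg (Real.cosh_pos _).le).trans
      (hmarkov.trans (hexp.trans hup))
  have hexpo : -(r ^ 2 / (2 * n * b ^ 2)) = n * ((l * b) ^ 2 / 2) - l * r := by
    rw [hl]
    field_simp
    ring
  rw [hexpo, Real.exp_sub, ← mul_div_assoc, le_div_iff₀ (Real.exp_pos _)]
  linarith

end VectorHoeffding

/-! ### Trace, operator and Frobenius norms -/

section SingularValues

variable {m n : ℕ}

/-- A matrix as a vector whose norm is the Frobenius norm. -/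
noncomputable def frobeniusVec (A : Matrix (Fin m) (Fin n) ℂ) :
    EuclideanSpace ℂ (Fin m × Fin n) :=
  WithLp.toLp 2 fun p => A p.1 p.2

/-- Both sides equal the trace of `Aᴴ * A`: in an eigenbasis and in the standard basis. -/
theorem sum_sq_singularValues (A : Matrix (Fin m) (Fin n) ℂ) :
    ∑ i : Fin n, (Matrix.toEuclideanLin A).singularValues (i : ℕ) ^ 2 =
      ‖frobeniusVec A‖ ^ 2 := by
  set T := Matrix.toEuclideanLin A with hT
  have hn : Module.finrank ℂ (EuclideanSpace ℂ (Fin n)) = n := by simp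
  simp only [T.sq_singularValues_fin hn]
  rw [← T.isSymmetric_adjoint_comp_self.re_trace_eq_sum_eigenvalues hn,
    LinearMap.trace_eq_sum_inner _ (EuclideanSpace.basisFun (Fin n) ℂ), map_sum,
    EuclideanSpace.norm_sq_eq, Fintype.sum_prod_type_right]
  refine Finset.sum_congr rfl fun j _ => ?_
  rw [LinearMap.comp_apply, LinearMap.adjoint_inner_right, inner_self_eq_norm_sq,
    EuclideanSpace.norm_sq_eq]
  refine Finset.sum_congr rfl fun i _ => ?_
  simp [hT, frobeniusVec, Matrix.toLpLin_apply]

theorem singularValues_le_operatorNorm (A : Matrix (Fin m) (Fin n) ℂ) (i : Fin n) :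
    (Matrix.toEuclideanLin A).singularValues (i : ℕ) ≤ operatorNorm A := by
  set T := Matrix.toEuclideanLin A with hT
  have hn : Module.finrank ℂ (EuclideanSpace ℂ (Fin n)) = n := by simp
  refine le_of_sq_le_sq ?_ (norm_nonneg _)
  set v := T.isSymmetric_adjoint_comp_self.eigenvectorBasis hn i with hv
  have h1 : ‖v‖ = 1 := OrthonormalBasis.norm_eq_one _ i
  -- A singular value is the length of the image of a unit eigenvector of `T† T`.
  have h2 : T.singularValues i ^ 2 = ‖T v‖ ^ 2 := by
    rw [T.sq_singularValues_fin hn, ← inner_self_eq_norm_sq (𝕜 := ℂ),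
      ← LinearMap.adjoint_inner_right, ← LinearMap.comp_apply,
      T.isSymmetric_adjoint_comp_self.apply_eigenvectorBasis hn, ← hv, inner_smul_right,
      inner_self_eq_norm_sq_to_K, h1]
    simp
  rw [h2]
  gcongr
  exact ((LinearMap.toContinuousLinearMap T).le_opNorm v).trans_eq (by rw [h1, mul_one]; rfl)

theorem norm_frobeniusVec_sq_le (A : Matrix (Fin m) (Fin n) ℂ) :
    ‖frobeniusVec A‖ ^ 2 ≤ traceNorm A * operatorNorm A := by
  rw [← sum_sq_singularValues, traceNorm, Finset.sum_mul]
  refine Finset.sum_le_sum fun i _ => ?_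
  rw [sq]
  exact mul_le_mul_of_nonneg_left (singularValues_le_operatorNorm A i)
    (LinearMap.singularValues_nonneg _ _)

theorem traceNorm_le_sqrt_mul_norm_frobeniusVec (A : Matrix (Fin m) (Fin n) ℂ) :
    traceNorm A ≤ √n * ‖frobeniusVec A‖ := by
  refine le_of_sq_le_sq ?_ (by positivity)
  rw [mul_pow, Real.sq_sqrt n.cast_nonneg, ← sum_sq_singularValues, traceNorm]
  simpa using sq_sum_le_card_mul_sum_sq (s := (Finset.univ : Finset (Fin n)))
    (f := fun i => (Matrix.toEuclideanLin A).singularValues (i : ℕ))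

end SingularValues

/-! ### Application to the sample average -/

theorem measurable_frobeniusVec {𝒳 : Type*} [MeasurableSpace 𝒳] {m n : ℕ}
    {A : 𝒳 → Matrix (Fin m) (Fin n) ℂ} (hA : ∀ i j, Measurable fun x => A x i j) :
    Measurable fun x => frobeniusVec (A x) :=
  (WithLp.measurable_toLp 2 _).comp (measurable_pi_lambda _ fun p => hA p.1 p.2)

theorem frobeniusVec_matrixExpectation {Ω 𝒳 : Type*} [MeasurableSpace Ω] {m n : ℕ}
    (P : Measure Ω) (X : Ω → 𝒳) (A : 𝒳 → Matrix (Fin m) (Fin n) ℂ)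
    (h : Integrable (fun ω => frobeniusVec (A (X ω))) P) :
    frobeniusVec (matrixExpectation P X A) = ∫ ω, frobeniusVec (A (X ω)) ∂P := by
  ext p
  exact (ContinuousLinearMap.integral_comp_comm
    (EuclideanSpace.proj p : EuclideanSpace ℂ (Fin m × Fin n) →L[ℂ] ℂ) h)

theorem frobeniusVec_sampleAverage_sub {𝒳 : Type*} {m n M : ℕ} (hM : 0 < M)
    (A : 𝒳 → Matrix (Fin m) (Fin n) ℂ) (x : Fin M → 𝒳) (B : Matrix (Fin m) (Fin n) ℂ) :
    frobeniusVec (sampleAverage A x - B) =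
      (M : ℝ)⁻¹ • ∑ k, (frobeniusVec (A (x k)) - frobeniusVec B) := by
  have hM' : (M : ℂ) ≠ 0 := by exact_mod_cast hM.ne'
  ext p
  simp [frobeniusVec, sampleAverage, Matrix.sum_apply, mul_sub, hM']

theorem lemma4
    {Ω₀ Ω 𝒳 : Type*} [MeasurableSpace Ω₀] [MeasurableSpace Ω] [MeasurableSpace 𝒳]
    -- the random variable `X` with values in `𝒳`
    (P₀ : Measure Ω₀) [IsProbabilityMeasure P₀] (X : Ω₀ → 𝒳) (hX : Measurable X)
    (d₁ d₂ : ℕ) (hd₂ : 0 < d₂) (hd : d₂ ≤ d₁)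
    (β : ℝ) (hβ : 1 ≤ β)
    (A : 𝒳 → Matrix (Fin d₁) (Fin d₂) ℂ)
    (hAmeas : ∀ i j, Measurable fun x => A x i j)
    (hA_one : ∀ x, traceNorm (A x) ≤ 1)
    (hA_infty : ∀ x, operatorNorm (A x) ≤ β / d₂)
    -- the sample: `M` independent random variables, each distributed as `X`
    (P : Measure Ω) [IsProbabilityMeasure P]
    (M : ℕ) (hM : 0 < M) (S : Fin M → Ω → 𝒳)
    (hS_meas : ∀ k, Measurable (S k))
    (hS_indep : iIndepFun S P)
    (hS_law : ∀ k, IdentDistrib (S k) X P P₀)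
    (ε : ℝ) (hε_pos : 0 < ε) (hε_lt : ε < 1) :
    P.real {ω | ε ≤ traceNorm
        (sampleAverage A (fun k => S k ω) - matrixExpectation P₀ X A)} ≤
      25 * (d₁ : ℝ) * Real.exp (-((10 : ℝ) ^ (-11 : ℤ) * ε ^ 3 * ((M : ℝ) / β))) := by
  have hβ0 : 0 < β := by linarith
  have hd₂' : (0 : ℝ) < d₂ := by exact_mod_cast hd₂
  have hM' : (0 : ℝ) < M := by exact_mod_cast hM
  set c : ℝ := √(β / d₂) with hc
  have hc0 : 0 < c := Real.sqrt_pos.2 (by positivity)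
  have hcsq : c ^ 2 = β / d₂ := Real.sq_sqrt (by positivity)
  have hnorm : ∀ x, ‖frobeniusVec (A x)‖ ≤ c := fun x => by
    refine Real.le_sqrt_of_sq_le ((norm_frobeniusVec_sq_le (A x)).trans ?_)
    refine (mul_le_mul (hA_one x) (hA_infty x) (norm_nonneg _) zero_le_one).trans_eq (one_mul _)
  have hvec := measurable_frobeniusVec hAmeas
  have hint : Integrable (fun ω => frobeniusVec (A (X ω))) P₀ :=
    integrable_of_measurable_of_norm_le (hvec.comp hX) fun ω => hnorm _
  set μ := frobeniusVec (matrixExpectation P₀ X A) with hμ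
  have hμint : μ = ∫ ω, frobeniusVec (A (X ω)) ∂P₀ :=
    frobeniusVec_matrixExpectation P₀ X A hint
  have hμnorm : ‖μ‖ ≤ c := by
    rw [hμint]
    simpa using norm_integral_le_of_norm_le_const (μ := P₀) (C := c)
      (Filter.Eventually.of_forall fun ω => hnorm (X ω))
  let Y : Fin M → Ω → EuclideanSpace ℂ (Fin d₁ × Fin d₂) :=
    fun k ω => frobeniusVec (A (S k ω)) - μ
  have hYmeas : ∀ k, Measurable (Y k) := fun k => (hvec.comp (hS_meas k)).sub_const μ
  -- Centring costs the factor 2, hence the 8 in the exponent.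
  have hYb : ∀ k ω, ‖Y k ω‖ ≤ 2 * c := fun k ω =>
    (norm_sub_le _ _).trans (by linarith [hnorm (S k ω)])
  have hYind : iIndepFun Y P := hS_indep.comp (fun _ x => frobeniusVec (A x) - μ)
    fun _ => hvec.sub_const μ
  have hY0 : ∀ k, ∫ ω, Y k ω ∂P = 0 := fun k => by
    have hid := (hS_law k).comp hvec
    change ∫ ω, ((fun x => frobeniusVec (A x)) ∘ S k) ω - μ ∂P = 0
    rw [integral_sub (integrable_of_measurable_of_norm_le (hvec.comp (hS_meas k))
      fun ω => hnorm _) (integrable_const μ)]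
    rw [hid.integral_eq, hμint]
    simp
  have hsub : P.real {ω | ε ≤ traceNorm
      (sampleAverage A (fun k => S k ω) - matrixExpectation P₀ X A)} ≤
      P.real {ω | M * ε / √d₂ ≤ ‖∑ k, Y k ω‖} := by
    refine measureReal_mono fun ω hω => ?_
    have h := (Set.mem_ofPred_eq ▸ hω).trans (traceNorm_le_sqrt_mul_norm_frobeniusVec _)
    rw [frobeniusVec_sampleAverage_sub hM, norm_smul, Real.norm_of_nonneg (by positivity)] at h
    have hs : 0 < √(d₂ : ℝ) := Real.sqrt_pos.2 hd₂'
    rw [Set.mem_ofPred_eq, div_le_iff₀ hs]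
    calc M * ε ≤ M * (√d₂ * ((M : ℝ)⁻¹ * ‖∑ k, Y k ω‖)) := by gcongr
      _ = _ := by field_simp
  refine hsub.trans ((measureReal_le_norm_sum_le hYmeas (b := 2 * c) (by positivity)
    (by positivity) (by simpa using hM) hYb hYind hY0).trans ?_)
  have hd₁ : (1 : ℝ) ≤ d₁ := by exact_mod_cast hd₂.trans_le hd
  refine mul_le_mul (by linarith) (Real.exp_le_exp.2 (neg_le_neg ?_)) (Real.exp_pos _).le
    (by positivity)
  rw [Fintype.card_fin, mul_pow, hcsq, div_pow, Real.sq_sqrt d₂.cast_nonneg]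
  have hcube : ε ^ 3 ≤ ε ^ 2 := pow_le_pow_of_le_one hε_pos.le hε_lt.le (by norm_num)
  -- The right side is the exponent `r²/(2Mb²)` at `r = Mε/√d₂`, `b = 2c`, where `d₂` cancels.
  calc (10 : ℝ) ^ (-11 : ℤ) * ε ^ 3 * (M / β) ≤ 1 / 8 * ε ^ 2 * (M / β) := by
        gcongr
        norm_num
    _ = _ := by
        field_simp
        norm_num
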